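/- Let $A$ be a unital $C^*$-algebra and let $u,v\in A$ be unitaries with $\|uv-vu\|<2$ such that $uvu^*v^*$ commutes with $u$ and with $v$. Let $A_{u,v}$ be the $C^*$-subalgebra of $A$ generated by $u$ and $v$, and let $T(A_{u,v})$ be the set of its tracial states. For $\theta\in\mathbb{R}$ let $A_\theta$ denote the rotation algebra, i.e. the universal $C^*$-algebra generated by two unitaries $u_\theta,v_\theta$ subject to $u_\theta v_\theta=e^{2\pi i\theta}v_\theta u_\theta$. Let $\log$ denote the continuous branch of the logarithm on $\{e^{it}: -\pi<t<\pi\}$ with $\log e^{it}=it$ (since $\|uvu^*v^*-1\|=\|uv-vu\|<2$, the point $-1$ is not in the spectrum of $uvu^*v^*$, so that $\log(uvu^*v^*)\in A_{u,v}$ is defined by continuous functional calculus). Let $\theta\in(-1/2,1/2)$ and suppose that $T(A_{u,v})\neq\emptyset$ and $$\frac{1}{2\pi i}\,\tau\bigl(\log(uvu^*v^*)\bigr)=\theta\qquad\text{for all }\tau\in T(A_{u,v}).$$ Then $A_{u,v}$ is isomorphic, as a $C^*$-algebra, to a quotient of $A_\theta$ by a closed two-sided ideal, and $uv=e^{2\pi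 i\theta}vu$. In particular, if $\theta$ is irrational, then $A_{u,v}\cong A_\theta$. -/

import Mathlib

open scoped ComplexOrder

noncomputable section

/-! ### The rotation algebra `A_θ`

`A_θ` is the universal C⋆-algebra generated by two unitaries `u_θ`, `v_θ` with
`u_θ v_θ = e^{2πiθ} v_θ u_θ`.  It is built in the usual way: take the free ⋆-algebra on two unitaries
(the group ⋆-algebra of the free group on two generators), form the supremum of all C⋆-seminorms
on it for which the relation holds, and pass to the Hausdorff completion. -/

/-- The free complex ⋆-algebra on two unitaries, i.e. the group algebra of the free group on two
generators.  The parameter `θ` only serves to equip it with a seminorm depending on `θ`. -/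
def PreRotation (_θ : ℝ) : Type := MonoidAlgebra ℂ (FreeGroup (Fin 2))

namespace PreRotation

variable {θ : ℝ}

instance : Ring (PreRotation θ) := inferInstanceAs (Ring (MonoidAlgebra ℂ (FreeGroup (Fin 2))))

instance : Algebra ℂ (PreRotation θ) :=
  inferInstanceAs (Algebra ℂ (MonoidAlgebra ℂ (FreeGroup (Fin 2))))

/-- The element `c • g` of the group algebra. -/
def single (g : FreeGroup (Fin 2)) (c : ℂ) : PreRotation θ := MonoidAlgebra.single g c

lemma single_mul (g h : FreeGroup (Fin 2)) (c d : ℂ) :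
    (single g c * single h d : PreRotation θ) = single (g * h) (c * d) :=
  MonoidAlgebra.single_mul_single ..

lemma one_eq : (1 : PreRotation θ) = single 1 1 := rfl

lemma smul_single (r : ℂ) (g : FreeGroup (Fin 2)) (c : ℂ) :
    (r • single g c : PreRotation θ) = single g (r * c) :=
  MonoidAlgebra.smul_single ..

lemma induction {P : PreRotation θ → Prop} (a : PreRotation θ) (h0 : P 0)
    (hs : ∀ g c, P (single g c)) (hadd : ∀ a b, P a → P b → P (a + b)) : P a := by
  obtain ⟨f⟩ := a
  induction f using Finsupp.induction_linear with
  | zero => exact h0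
  | add f g hf hg => exact hadd _ _ hf hg
  | single g c => exact hs g c

/-- The involution on the group algebra, as an additive map: `(∑ c_g g)⋆ = ∑ conj(c_g) g⁻¹`. -/
def starHomAux :
    MonoidAlgebra ℂ (FreeGroup (Fin 2)) →+ MonoidAlgebra ℂ (FreeGroup (Fin 2)) where
  toFun a := MonoidAlgebra.map (starAddEquiv : ℂ ≃+ ℂ).toAddMonoidHom
    (MonoidAlgebra.mapDomain (fun g : FreeGroup (Fin 2) => g⁻¹) a)
  map_zero' := by rw [MonoidAlgebra.mapDomain_zero, MonoidAlgebra.map_zero]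
  map_add' a b := by rw [MonoidAlgebra.mapDomain_add, MonoidAlgebra.map_add]

/-- The involution on `PreRotation θ`, as an additive map. -/
def starHom : PreRotation θ →+ PreRotation θ := starHomAux

lemma starHom_single (g : FreeGroup (Fin 2)) (c : ℂ) :
    starHom (single g c : PreRotation θ) = single g⁻¹ (star c) := by
  have : starHomAux (MonoidAlgebra.single g c) = MonoidAlgebra.single g⁻¹ (star c) := by
    simp [starHomAux]
  exact this

instance : StarRing (PreRotation θ) where
  star := starHom
  star_involutive a := by
    show starHom (starHom a) = a
    induction a using induction with
    | h0 => simp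
    | hs g c => simp [starHom_single]
    | hadd a b ha hb => rw [map_add, map_add, ha, hb]
  star_mul a b := by
    show starHom (a * b) = starHom b * starHom a
    induction a using induction with
    | h0 => simp
    | hadd a a' ha ha' => rw [add_mul, map_add, map_add, ha, ha', mul_add]
    | hs g c =>
      induction b using induction with
      | h0 => simp
      | hadd b b' hb hb' => rw [mul_add, map_add, map_add, hb, hb', add_mul]
      | hs h d => simp [starHom_single, single_mul, mul_comm]
  star_add := map_add starHom

lemma star_single (g : FreeGroup (Fin 2)) (c : ℂ) :
    star (single g c : PreRotation θ) = single g⁻¹ (star c) := starHom_single g c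

instance : StarModule ℂ (PreRotation θ) where
  star_smul r a := by
    induction a using induction with
    | h0 => simp
    | hs g c => simp [star_single, smul_single]
    | hadd a b ha hb => rw [smul_add, star_add, star_add, ha, hb, smul_add]

/-- The first free unitary. -/
def U : PreRotation θ := single (FreeGroup.of 0) 1

/-- The second free unitary. -/
def V : PreRotation θ := single (FreeGroup.of 1) 1

/-- The C⋆-seminorms on the free ⋆-algebra on two unitaries `U`, `V` for which the relation
`U V = e^{2πiθ} V U` holds. -/
structure IsAdmissible (p : Seminorm ℂ (PreRotation θ)) : Prop where
  mul_le : ∀ a b, p (a * b) ≤ p a * p b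
  star_mul_self : ∀ a, p (star a * a) = p a ^ 2
  relation : p (U * V - Complex.exp (2 * Real.pi * Complex.I * θ) • (V * U)) = 0

variable (θ) in
/-- The type of admissible C⋆-seminorms. -/
abbrev Admissible : Type := {p : Seminorm ℂ (PreRotation θ) // IsAdmissible p}

instance : Nonempty (Admissible θ) :=
  ⟨⟨0, ⟨fun _ _ => by simp, fun _ => by simp, by simp⟩⟩⟩

lemma IsAdmissible.single_le {p : Seminorm ℂ (PreRotation θ)} (hp : IsAdmissible p)
    (g : FreeGroup (Fin 2)) (c : ℂ) : p (single g c) ≤ ‖c‖ := by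
  have h1 : p (single 1 1) = p (single 1 1) ^ 2 := by
    have := hp.star_mul_self (single 1 1)
    simpa [star_single, single_mul] using this
  have h2 : p (single g 1) ^ 2 = p (single 1 1) := by
    have := hp.star_mul_self (single g 1)
    simpa [star_single, single_mul] using this.symm
  have h3 : p (single 1 1) ≤ 1 := by nlinarith [apply_nonneg p (single (θ := θ) 1 1)]
  have h4 : p (single g 1) ≤ 1 := by nlinarith [apply_nonneg p (single (θ := θ) g 1)]
  have h5 : (single g c : PreRotation θ) = c • single g 1 := by simp [smul_single]
  rw [h5, map_smul_eq_mul]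
  exact mul_le_of_le_one_right (norm_nonneg c) h4

lemma bddAbove (a : PreRotation θ) :
    BddAbove (Set.range fun p : Admissible θ => p.1 a) := by
  induction a using induction with
  | h0 => exact ⟨0, by rintro _ ⟨p, rfl⟩; simp⟩
  | hs g c => exact ⟨‖c‖, by rintro _ ⟨p, rfl⟩; exact p.2.single_le g c⟩
  | hadd a b ha hb =>
    obtain ⟨x, hx⟩ := ha
    obtain ⟨y, hy⟩ := hb
    refine ⟨x + y, ?_⟩
    rintro _ ⟨p, rfl⟩
    exact (map_add_le_add p.1 a b).trans (add_le_add (hx ⟨p, rfl⟩) (hy ⟨p, rfl⟩))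

/-- The universal C⋆-seminorm: the supremum of all admissible C⋆-seminorms. -/
def universalNorm (a : PreRotation θ) : ℝ := ⨆ p : Admissible θ, p.1 a

lemma le_universalNorm (p : Admissible θ) (a : PreRotation θ) : p.1 a ≤ universalNorm a :=
  le_ciSup (bddAbove a) p

lemma universalNorm_le {a : PreRotation θ} {r : ℝ} (h : ∀ p : Admissible θ, p.1 a ≤ r) :
    universalNorm a ≤ r := ciSup_le h

lemma universalNorm_nonneg (a : PreRotation θ) : 0 ≤ universalNorm a :=
  Real.iSup_nonneg fun p => apply_nonneg p.1 a

instance : SeminormedRing (PreRotation θ) :=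
  RingSeminorm.toSeminormedRing
    { toFun := universalNorm
      map_zero' := by simp [universalNorm]
      add_le' := fun a b => universalNorm_le fun p => (map_add_le_add p.1 a b).trans
        (add_le_add (le_universalNorm p a) (le_universalNorm p b))
      neg' := fun a => by simp [universalNorm]
      mul_le' := fun a b => universalNorm_le fun p => (p.2.mul_le a b).trans
        (mul_le_mul (le_universalNorm p a) (le_universalNorm p b) (apply_nonneg _ _)
          (universalNorm_nonneg a)) }

lemma norm_def (a : PreRotation θ) : ‖a‖ = universalNorm a := rfl

instance : NormedAlgebra ℂ (PreRotation θ) where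
  norm_smul_le r a := universalNorm_le fun p => by
    rw [map_smul_eq_mul]
    exact mul_le_mul_of_nonneg_left (le_universalNorm p a) (norm_nonneg r)

lemma norm_sq_le (a : PreRotation θ) : ‖a‖ * ‖a‖ ≤ ‖star a * a‖ := by
  have h : ‖a‖ ≤ Real.sqrt ‖star a * a‖ := universalNorm_le fun p =>
    Real.le_sqrt_of_sq_le (by
      rw [← p.2.star_mul_self a]; exact le_universalNorm p _)
  calc ‖a‖ * ‖a‖ ≤ Real.sqrt ‖star a * a‖ * Real.sqrt ‖star a * a‖ :=
        mul_self_le_mul_self (norm_nonneg a) h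
    _ = ‖star a * a‖ := Real.mul_self_sqrt (norm_nonneg _)

lemma norm_le_norm_star (a : PreRotation θ) : ‖a‖ ≤ ‖star a‖ := by
  by_contra! hlt
  have h1 := (norm_sq_le a).trans (norm_mul_le (star a) a)
  nlinarith [norm_nonneg (star a)]

instance : NormedStarGroup (PreRotation θ) where
  norm_star_le a := by simpa using norm_le_norm_star (star a)

end PreRotation

/-- The rotation algebra `A_θ`: the Hausdorff completion of the free ⋆-algebra on two unitaries in
the universal C⋆-seminorm. -/
def RotationAlgebra (θ : ℝ) : Type := UniformSpace.Completion (PreRotation θ)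

namespace RotationAlgebra

open UniformSpace

variable {θ : ℝ}

instance : NormedRing (RotationAlgebra θ) :=
  inferInstanceAs (NormedRing (Completion (PreRotation θ)))

instance : CompleteSpace (RotationAlgebra θ) :=
  inferInstanceAs (CompleteSpace (Completion (PreRotation θ)))

instance : Algebra ℂ (RotationAlgebra θ) :=
  inferInstanceAs (Algebra ℂ (Completion (PreRotation θ)))

/-- The canonical map from the free ⋆-algebra on two unitaries to `A_θ`. -/
def of (a : PreRotation θ) : RotationAlgebra θ := (a : Completion (PreRotation θ))

lemma norm_of (a : PreRotation θ) : ‖of a‖ = ‖a‖ := Completion.norm_coe a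

lemma of_add (a b : PreRotation θ) : of (a + b) = of a + of b := Completion.coe_add a b

lemma of_mul (a b : PreRotation θ) : of (a * b) = of a * of b := Completion.coe_mul a b

lemma of_smul (r : ℂ) (a : PreRotation θ) : of (r • a) = r • of a := Completion.coe_smul r a

lemma continuous_of : Continuous (of : PreRotation θ → RotationAlgebra θ) :=
  Completion.continuous_coe _

lemma denseRange_of : DenseRange (of : PreRotation θ → RotationAlgebra θ) :=
  Completion.denseRange_coe

instance : NormedAlgebra ℂ (RotationAlgebra θ) where
  norm_smul_le r a := norm_smul_le (β := Completion (PreRotation θ)) r a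

instance : Star (RotationAlgebra θ) where
  star := Completion.map (star : PreRotation θ → PreRotation θ)

lemma continuous_star' : Continuous (star : RotationAlgebra θ → RotationAlgebra θ) :=
  Completion.continuous_map

lemma star_of (a : PreRotation θ) : star (of a) = of (star a) :=
  Completion.map_coe (starₗᵢ ℂ : PreRotation θ ≃ₗᵢ⋆[ℂ] PreRotation θ).isometry.uniformContinuous a

lemma induction {P : RotationAlgebra θ → Prop} (a : RotationAlgebra θ)
    (hc : IsClosed {a | P a}) (h : ∀ a, P (of a)) : P a :=
  denseRange_of.induction_on a hc h

instance : StarRing (RotationAlgebra θ) where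
  star_involutive a := by
    induction a using induction with
    | hc => exact isClosed_eq (continuous_star'.comp continuous_star') continuous_id
    | h a => rw [star_of, star_of, star_star]
  star_mul a b := by
    induction a using induction with
    | hc => exact isClosed_eq (continuous_star'.comp (continuous_id.mul continuous_const))
              (continuous_const.mul continuous_star')
    | h a =>
      induction b using induction with
      | hc => exact isClosed_eq (continuous_star'.comp (continuous_const.mul continuous_id))
                (continuous_star'.mul continuous_const)
      | h b => simp only [← of_mul, star_of, star_mul]
  star_add a b := by
    induction a using induction with
    | hc => exact isClosed_eq (continuous_star'.comp (continuous_id.add continuous_const))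
              (continuous_star'.add continuous_const)
    | h a =>
      induction b using induction with
      | hc => exact isClosed_eq (continuous_star'.comp (continuous_const.add continuous_id))
                (continuous_const.add continuous_star')
      | h b => simp only [← of_add, star_of, star_add]

/-- `A_θ` is a unital C⋆-algebra. -/
instance : CStarAlgebra (RotationAlgebra θ) where
  norm_mul_self_le a := by
    induction a using induction with
    | hc => exact isClosed_le (continuous_norm.mul continuous_norm)
              (continuous_norm.comp (continuous_star'.mul continuous_id))
    | h a => rw [star_of, ← of_mul, norm_of, norm_of]; exact PreRotation.norm_sq_le a
  star_smul r a := by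
    induction a using induction with
    | hc => exact isClosed_eq (continuous_star'.comp (continuous_const_smul r))
              ((continuous_const_smul (star r)).comp continuous_star')
    | h a => simp only [← of_smul, star_of, star_smul]

end RotationAlgebra

/-! ### The C⋆-subalgebra generated by two elements, tracial states, quotients -/

/-- The (unital) C⋆-subalgebra of `A` generated by `u` and `v`. -/
def cstarGenerated {A : Type*} [CStarAlgebra A] (u v : A) : StarSubalgebra ℂ A :=
  (StarAlgebra.adjoin ℂ {u, v}).topologicalClosure

namespace cstarGenerated

variable {A : Type*} [CStarAlgebra A] (u v : A)

instance : IsClosed (cstarGenerated u v : Set A) :=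
  StarSubalgebra.isClosed_topologicalClosure _

/-- `u` as an element of the C⋆-subalgebra generated by `u` and `v`. -/
def fst : cstarGenerated u v :=
  ⟨u, StarSubalgebra.le_topologicalClosure _ (StarAlgebra.subset_adjoin ℂ _ (by simp))⟩

/-- `v` as an element of the C⋆-subalgebra generated by `u` and `v`. -/
def snd : cstarGenerated u v :=
  ⟨v, StarSubalgebra.le_topologicalClosure _ (StarAlgebra.subset_adjoin ℂ _ (by simp))⟩

/-- `u v u⋆ v⋆` as an element of the C⋆-subalgebra generated by `u` and `v`. -/
def commutator : cstarGenerated u v :=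
  fst u v * snd u v * star (fst u v) * star (snd u v)

end cstarGenerated

/-- A tracial state on a unital C⋆-algebra: a positive unital tracial linear functional. -/
structure TracialState (B : Type*) [CStarAlgebra B] where
  /-- The underlying linear functional. -/
  toLinearMap : B →ₗ[ℂ] ℂ
  nonneg : ∀ b, 0 ≤ toLinearMap (star b * b)
  map_one : toLinearMap 1 = 1
  trace : ∀ a b, toLinearMap (a * b) = toLinearMap (b * a)

/-- The logarithm of a normal element, by continuous functional calculus with the principal branch
(the values of which on the unit circle without `-1` lie in `i(-π, π)`). -/
def cstarLog {B : Type*} [CStarAlgebra B] (w : B) : B := cfc Complex.log w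

/-- `B` is isomorphic, as a C⋆-algebra, to the quotient of `A` by a closed two-sided ideal `I`: there
is an algebra isomorphism `A ⧸ I ≃ B` that respects the involutions (that of `A ⧸ I` being
`(a + I)⋆ = a⋆ + I`) and is isometric for the quotient norm `‖a + I‖ = inf_{x ∈ I} ‖a - x‖`. -/
def IsIsomorphicToQuotient (B A : Type*) [CStarAlgebra B] [CStarAlgebra A] : Prop :=
  ∃ (I : Ideal A) (_ : I.IsTwoSided) (e : (A ⧸ I) ≃ₐ[ℂ] B),
    IsClosed (I : Set A) ∧
    (∀ a : A, e (Ideal.Quotient.mk I (star a)) = star (e (Ideal.Quotient.mk I a))) ∧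
    ∀ a : A, ‖e (Ideal.Quotient.mk I a)‖ = Metric.infDist a (I : Set A)

end

/-!
The commutator `w = u v u⋆ v⋆` is central in `A_{u,v}`, so conjugations by `u` and by `v` commute.
Averaging a state first over the powers of one and then over those of the other gives a tracial
state that agrees with it on the centre. Hence every state takes the value `2πiθ` at the central
element `log w`; states separate normal elements, so `log w = 2πiθ` and `uv = e^{2πiθ} vu`. By
universality `A_θ` maps to `A_{u,v}`, with dense and therefore full image.

For irrational `θ` the relation forces a trace to vanish on `u^m v^n` unless `m = n = 0`, so `A_θ`
has only one trace. The average of any state over the gauge action of the torus is a trace, so it is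
this one; as states separate normal elements, the trace is faithful. It is the pullback of a trace
on `A_{u,v}`, so the kernel of `A_θ → A_{u,v}` vanishes.
-/

open Filter Topology

noncomputable section

section States

variable {D : Type*} [CStarAlgebra D] {φ : D →L[ℂ] ℂ}

/-- States of a unital C⋆-algebra, encoded as contractive unital functionals; positivity is
`IsState.nonneg`. -/
structure IsState (φ : D →L[ℂ] ℂ) : Prop where
  norm_le_one : ‖φ‖ ≤ 1
  map_one : φ 1 = 1

namespace IsState

lemma nontrivial (hφ : IsState φ) : Nontrivial D :=
  ⟨1, 0, fun h => zero_ne_one <| by rw [← hφ.map_one, h, map_zero]⟩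

lemma norm_apply_le (hφ : IsState φ) (a : D) : ‖φ a‖ ≤ ‖a‖ :=
  φ.le_of_opNorm_le hφ.norm_le_one a |>.trans_eq (one_mul _)

lemma im_apply_eq_zero (hφ : IsState φ) {a : D} (ha : IsSelfAdjoint a) : (φ a).im = 0 := by
  have := hφ.nontrivial
  -- Since `φ (a + it) = φ a + it`, `2 t (φ a).im` is bounded above independently of `t`.
  have hbound (t : ℝ) : ((φ a).im + t) ^ 2 ≤ ‖a‖ ^ 2 + t ^ 2 := by
    set b : D := algebraMap ℂ D (t * Complex.I)
    have hb : star b = -b := by rw [← algebraMap_star_comm, ← map_neg]; simp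
    have hbb : b * b = -algebraMap ℂ D ((t : ℂ) ^ 2) := by
      rw [← map_mul, mul_mul_mul_comm, Complex.I_mul_I, mul_neg_one, map_neg, sq]
    have hab : star (a + b) * (a + b) = a * a + algebraMap ℂ D ((t : ℂ) ^ 2) := by
      have hcomm : Commute a b := (Algebra.commutes _ a).symm
      rw [star_add, ha.star_eq, hb, ← sub_eq_add_neg, ← hcomm.mul_self_sub_mul_self_eq', hbb,
        sub_neg_eq_add]
    have hφb : φ (a + b) = φ a + t * Complex.I := by
      simp [b, Algebra.algebraMap_eq_smul_one, hφ.map_one]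
    calc ((φ a).im + t) ^ 2 = (φ (a + b)).im ^ 2 := by simp [hφb]
      _ ≤ ‖φ (a + b)‖ ^ 2 := sq_le_sq.2 <|
        (Complex.abs_im_le_norm _).trans_eq (abs_norm _).symm
      _ ≤ ‖a + b‖ ^ 2 := by gcongr; exact hφ.norm_apply_le _
      _ = ‖a * a + algebraMap ℂ D ((t : ℂ) ^ 2)‖ := by
        rw [sq, ← CStarRing.norm_star_mul_self, hab]
      _ ≤ ‖a‖ ^ 2 + t ^ 2 := (norm_add_le _ _).trans <|
        add_le_add ((norm_mul_le _ _).trans_eq (sq _).symm) (by rw [norm_algebraMap']; simp)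
  by_contra h
  have := hbound ((‖a‖ ^ 2 + 1) / (2 * (φ a).im))
  have : 2 * (φ a).im * ((‖a‖ ^ 2 + 1) / (2 * (φ a).im)) = ‖a‖ ^ 2 + 1 := by field_simp
  nlinarith [sq_nonneg (φ a).im]

lemma nonneg (hφ : IsState φ) (b : D) : 0 ≤ φ (star b * b) := by
  let := CStarAlgebra.spectralOrder D
  have := CStarAlgebra.spectralOrderedRing D
  have := hφ.nontrivial
  set a := star b * b
  have ha : 0 ≤ a := star_mul_self_nonneg b
  have hle : a ≤ algebraMap ℝ D ‖a‖ := IsSelfAdjoint.le_algebraMap_norm_self (.of_nonneg ha)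
  have hφ_sub : ‖(‖a‖ : ℂ) - φ a‖ ≤ ‖a‖ := calc
    ‖(‖a‖ : ℂ) - φ a‖ = ‖φ (algebraMap ℝ D ‖a‖ - a)‖ := by
      rw [map_sub, Algebra.algebraMap_eq_smul_one, ← Complex.coe_smul, map_smul, hφ.map_one]
      simp
    _ ≤ ‖algebraMap ℝ D ‖a‖ - a‖ := hφ.norm_apply_le _
    _ ≤ ‖algebraMap ℝ D ‖a‖‖ :=
      CStarAlgebra.norm_le_norm_of_nonneg_of_le (sub_nonneg.2 hle) (sub_le_self _ ha)
    _ = ‖a‖ := by rw [norm_algebraMap', norm_norm]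
  have hre := abs_le.1 ((Complex.abs_re_le_norm _).trans hφ_sub)
  rw [Complex.sub_re, Complex.ofReal_re] at hre
  exact Complex.le_def.2
    ⟨by simpa using hre.2, (hφ.im_apply_eq_zero (.of_nonneg ha)).symm⟩

end IsState

lemma exists_mem_spectrum_ne_zero {a : D} [IsStarNormal a] (ha : a ≠ 0) :
    ∃ z ∈ spectrum ℂ a, z ≠ 0 := by
  by_contra! h
  have hr : spectralRadius ℂ a = 0 := by
    simp only [spectralRadius, ENNReal.iSup_eq_zero]
    intro z hz
    simp [h z hz]
  rw [IsStarNormal.spectralRadius_eq_nnnorm] at hr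
  exact ha (by simpa using hr)

lemma exists_isState_apply_ne_zero {a : D} [IsStarNormal a] (ha : a ≠ 0) :
    ∃ φ : D →L[ℂ] ℂ, IsState φ ∧ φ a ≠ 0 := by
  have : Nontrivial D := ⟨a, 0, ha⟩
  obtain ⟨z, hz, hz0⟩ := exists_mem_spectrum_ne_zero ha
  obtain ⟨χ, hχ⟩ := (StarAlgebra.elemental.bijective_characterSpaceToSpectrum a).2 ⟨z, hz⟩
  obtain ⟨φ, hφ, hφ_norm⟩ := exists_extension_norm_eq
    (StarAlgebra.elemental ℂ a).toSubalgebra.toSubmodule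
    (WeakDual.toStrongDual (χ : WeakDual ℂ (StarAlgebra.elemental ℂ a)))
  refine ⟨φ, ⟨?_, (hφ ⟨1, one_mem (StarAlgebra.elemental ℂ a)⟩).trans (map_one χ)⟩, ?_⟩
  · rw [hφ_norm]
    refine ContinuousLinearMap.opNorm_le_bound _ zero_le_one fun x => ?_
    rw [one_mul]
    exact AlgHom.norm_apply_le_self (A := StarAlgebra.elemental ℂ a) χ x
  · have hφa : φ a = z :=
      (hφ ⟨a, StarAlgebra.elemental.self_mem ℂ a⟩).trans (congrArg Subtype.val hχ)
    rwa [hφa]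

end States

section Averaging

variable {𝕜 E : Type*} [RCLike 𝕜] [SeminormedAddCommGroup E] [NormedSpace 𝕜 E]
  {T : E →L[𝕜] E}

lemma norm_iterate_apply_le (hT : ‖T‖ ≤ 1) (n : ℕ) (x : E) : ‖T^[n] x‖ ≤ ‖x‖ := by
  induction n with
  | zero => rfl
  | succ n ih =>
    rw [Function.iterate_succ_apply']
    exact (T.le_of_opNorm_le hT _).trans ((one_mul _).trans_le ih)

lemma norm_birkhoffAverage_le (hT : ‖T‖ ≤ 1) (f : E →L[𝕜] 𝕜) (n : ℕ) (x : E) :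
    ‖birkhoffAverage 𝕜 T f n x‖ ≤ ‖f‖ * ‖x‖ := by
  rw [birkhoffAverage, birkhoffSum, norm_smul, norm_inv, RCLike.norm_natCast]
  rcases n.eq_zero_or_pos with rfl | hn
  · simpa using by positivity
  · rw [inv_mul_le_iff₀ (by positivity)]
    calc ‖∑ k ∈ Finset.range n, f (T^[k] x)‖ ≤ ∑ _k ∈ Finset.range n, ‖f‖ * ‖x‖ :=
          norm_sum_le_of_le _ fun k _ => f.le_opNorm_of_le (norm_iterate_apply_le hT k x)
      _ = n * (‖f‖ * ‖x‖) := by simp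

/-- The value at `x` of the mean of the functionals `f ∘ T ^ n`: the limit of the Birkhoff averages
along a fixed nonprincipal ultrafilter on `ℕ`. -/
def ergodicMeanFun (T : E →L[𝕜] E) (f : E →L[𝕜] 𝕜) (x : E) : 𝕜 :=
  limUnder (hyperfilter ℕ : Filter ℕ) fun n => birkhoffAverage 𝕜 T f n x

lemma tendsto_birkhoffAverage_ergodicMeanFun (hT : ‖T‖ ≤ 1) (f : E →L[𝕜] 𝕜) (x : E) :
    Tendsto (fun n => birkhoffAverage 𝕜 T f n x) (hyperfilter ℕ) (𝓝 (ergodicMeanFun T f x)) := by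
  obtain ⟨z, -, hz⟩ := (isCompact_closedBall (0 : 𝕜) (‖f‖ * ‖x‖)).ultrafilter_le_nhds
    ((hyperfilter ℕ).map fun n => birkhoffAverage 𝕜 T f n x)
    (le_principal_iff.2 <| mem_map.2 <| univ_mem' fun n =>
      mem_closedBall_zero_iff.2 (norm_birkhoffAverage_le hT f n x))
  exact tendsto_nhds_limUnder ⟨z, hz⟩

/-- The mean of the functionals `f ∘ T ^ n` for a contraction `T`. -/
def ergodicMean (hT : ‖T‖ ≤ 1) (f : E →L[𝕜] 𝕜) : E →L[𝕜] 𝕜 :=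
  LinearMap.mkContinuous
    { toFun := ergodicMeanFun T f
      map_add' := fun x y => by
        refine tendsto_nhds_unique (tendsto_birkhoffAverage_ergodicMeanFun hT f (x + y))
          (((tendsto_birkhoffAverage_ergodicMeanFun hT f x).add
            (tendsto_birkhoffAverage_ergodicMeanFun hT f y)).congr fun n => ?_)
        simp only [birkhoffAverage, birkhoffSum, iterate_map_add, map_add,
          Finset.sum_add_distrib, smul_add]
      map_smul' := fun c x => by
        have hc (k : ℕ) : T^[k] (c • x) = c • T^[k] x :=
          Function.Commute.iterate_left (f := T) (g := (c • ·)) (map_smul T c) k x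
        refine tendsto_nhds_unique (tendsto_birkhoffAverage_ergodicMeanFun hT f (c • x))
          (((tendsto_birkhoffAverage_ergodicMeanFun hT f x).const_smul c).congr fun n => ?_)
        simp only [birkhoffAverage, birkhoffSum, hc, map_smul, ← Finset.smul_sum, smul_comm c] }
    ‖f‖ fun x => le_of_tendsto (tendsto_birkhoffAverage_ergodicMeanFun hT f x).norm
      (.of_forall fun n => norm_birkhoffAverage_le hT f n x)

lemma tendsto_birkhoffAverage_ergodicMean (hT : ‖T‖ ≤ 1) (f : E →L[𝕜] 𝕜) (x : E) :
    Tendsto (fun n => birkhoffAverage 𝕜 T f n x) (hyperfilter ℕ) (𝓝 (ergodicMean hT f x)) :=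
  tendsto_birkhoffAverage_ergodicMeanFun hT f x

lemma norm_ergodicMean_le (hT : ‖T‖ ≤ 1) (f : E →L[𝕜] 𝕜) : ‖ergodicMean hT f‖ ≤ ‖f‖ :=
  LinearMap.mkContinuous_norm_le _ (norm_nonneg f) _

lemma ergodicMean_apply_map (hT : ‖T‖ ≤ 1) (f : E →L[𝕜] 𝕜) (x : E) :
    ergodicMean hT f (T x) = ergodicMean hT f x := by
  have hbdd : Bornology.IsBounded (Set.range fun n => f (T^[n] x)) :=
    (Metric.isBounded_closedBall (x := (0 : 𝕜)) (r := ‖f‖ * ‖x‖)).subset <|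
      Set.range_subset_iff.2 fun n => mem_closedBall_zero_iff.2 <|
        f.le_opNorm_of_le (norm_iterate_apply_le hT n x)
  exact sub_eq_zero.1 <| tendsto_nhds_unique
    ((tendsto_birkhoffAverage_ergodicMean hT f (T x)).sub
      (tendsto_birkhoffAverage_ergodicMean hT f x))
    ((tendsto_birkhoffAverage_apply_sub_birkhoffAverage 𝕜 hbdd).mono_left
      Nat.hyperfilter_le_atTop)

lemma ergodicMean_apply_of_isFixedPt (hT : ‖T‖ ≤ 1) (f : E →L[𝕜] 𝕜) {x : E}
    (hx : Function.IsFixedPt T x) : ergodicMean hT f x = f x :=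
  tendsto_nhds_unique (tendsto_birkhoffAverage_ergodicMean hT f x)
    ((hx.tendsto_birkhoffAverage 𝕜 f).mono_left Nat.hyperfilter_le_atTop)

lemma ergodicMean_apply_map_of_commute (hT : ‖T‖ ≤ 1) {f : E →L[𝕜] 𝕜} {S : E →L[𝕜] E}
    (hST : Commute S T) (hS : ∀ x, f (S x) = f x) (x : E) :
    ergodicMean hT f (S x) = ergodicMean hT f x := by
  refine tendsto_nhds_unique (tendsto_birkhoffAverage_ergodicMean hT f (S x))
    ((tendsto_birkhoffAverage_ergodicMean hT f x).congr fun n => ?_)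
  have hST' : Function.Commute S T := DFunLike.congr_fun hST.eq
  have hSn (k : ℕ) : T^[k] (S x) = S (T^[k] x) := (hST'.iterate_right k x).symm
  simp only [birkhoffAverage, birkhoffSum, hSn, hS]

end Averaging

section CompactGroupMean

open MeasureTheory
open scoped CStarAlgebra

variable {D : Type*} [CStarAlgebra D] {G : Type*} [Group G] [TopologicalSpace G]
  [IsTopologicalGroup G] [CompactSpace G] {α : G →* (D →⋆ₐ[ℂ] D)}

section Integral

variable [MeasurableSpace G] [BorelSpace G] (μ : Measure G) [IsProbabilityMeasure μ]

lemma integrable_apply_inv (hα : ∀ a, Continuous fun g => α g a)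
    (φ : D →L[ℂ] ℂ) (a : D) : Integrable (fun g => φ (α g⁻¹ a)) μ :=
  (φ.continuous.comp ((hα a).comp continuous_inv)).integrable_of_hasCompactSupport
    (.of_compactSpace _)

/-- The mean `a ↦ ∫ φ (α g⁻¹ a) dμ(g)` of a functional over a group action; with the inverse, left
invariance of `μ` yields invariance under `α`. -/
def orbitMean (hα : ∀ a, Continuous fun g => α g a) (φ : D →L[ℂ] ℂ) : D →L[ℂ] ℂ :=
  LinearMap.mkContinuous
    { toFun := fun a => ∫ g, φ (α g⁻¹ a) ∂μ
      map_add' := fun a b => by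
        simp only [map_add]
        exact integral_add (integrable_apply_inv μ hα φ a) (integrable_apply_inv μ hα φ b)
      map_smul' := fun c a => by
        simp only [map_smul]
        exact integral_smul c _ }
    ‖φ‖ fun a => by
      simpa using norm_integral_le_of_norm_le_const (μ := μ) <| .of_forall fun g =>
        φ.le_opNorm_of_le (NonUnitalStarAlgHom.norm_apply_le (α g⁻¹) a)

variable (hα : ∀ a, Continuous fun g => α g a) {φ : D →L[ℂ] ℂ}

lemma orbitMean_apply (φ : D →L[ℂ] ℂ) (a : D) :
    orbitMean μ hα φ a = ∫ g, φ (α g⁻¹ a) ∂μ := rfl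

lemma isState_orbitMean (hφ : IsState φ) : IsState (orbitMean μ hα φ) where
  norm_le_one := (LinearMap.mkContinuous_norm_le _ (norm_nonneg φ) _).trans hφ.norm_le_one
  map_one := by simp [orbitMean_apply, hφ.map_one]

lemma orbitMean_apply_map [μ.IsMulLeftInvariant] (φ : D →L[ℂ] ℂ) (g : G) (a : D) :
    orbitMean μ hα φ (α g a) = orbitMean μ hα φ a := by
  have h (x : G) : α x⁻¹ (α g a) = α (g⁻¹ * x)⁻¹ a := by
    rw [mul_inv_rev, inv_inv, map_mul]; rfl
  simp only [orbitMean_apply, h]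
  exact integral_mul_left_eq_self (fun x => φ (α x⁻¹ a)) g⁻¹

lemma apply_eq_zero_of_orbitMean_apply_eq_zero [μ.IsOpenPosMeasure] (hφ : IsState φ)
    {a : D} (ha : orbitMean μ hα φ (star a * a) = 0) : φ (star a * a) = 0 := by
  let F : G → ℂ := fun g => φ (α g⁻¹ (star a * a))
  have hF_nonneg (g : G) : 0 ≤ F g := by
    simp only [F, map_mul, map_star]
    exact hφ.nonneg _
  have hF_cont : Continuous F := φ.continuous.comp ((hα _).comp continuous_inv)
  have hF_one : F 1 = φ (star a * a) := by
    simp only [F, inv_one, map_one]; rfl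
  have hF_int : ∫ g, (F g).re ∂μ = 0 := by
    have := integral_re (𝕜 := ℂ) (integrable_apply_inv μ hα φ (star a * a))
    rw [← orbitMean_apply μ hα, ha] at this
    exact this
  by_contra hne
  have hre : (F 1).re ≠ 0 := fun h =>
    hne (hF_one ▸ Complex.ext h (Complex.le_def.1 (hF_nonneg 1)).2.symm)
  exact (Continuous.integral_pos_of_hasCompactSupport_nonneg_nonzero
    (Complex.continuous_re.comp hF_cont) (.of_compactSpace _)
    (fun g => (Complex.le_def.1 (hF_nonneg g)).1) hre).ne' hF_int

end Integral

lemma IsState.exists_invariant (hα : ∀ a, Continuous fun g => α g a) {φ : D →L[ℂ] ℂ}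
    (hφ : IsState φ) : ∃ ψ : D →L[ℂ] ℂ, IsState ψ ∧ (∀ g a, ψ (α g a) = ψ a) ∧
      ∀ a, ψ (star a * a) = 0 → φ (star a * a) = 0 := by
  let : MeasurableSpace G := borel G
  have : BorelSpace G := ⟨rfl⟩
  let μ : Measure G := Measure.haarMeasure ⊤
  have : IsProbabilityMeasure μ := ⟨Measure.haarMeasure_self (K₀ := ⊤)⟩
  exact ⟨orbitMean μ hα φ, isState_orbitMean μ hα hφ, orbitMean_apply_map μ hα φ,
    fun a => apply_eq_zero_of_orbitMean_apply_eq_zero μ hα hφ⟩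

end CompactGroupMean

section Generators

open scoped CStarAlgebra commutatorElement

variable {D : Type*} [CStarAlgebra D]

lemma cstarGenerated_fst_snd (u v : D) :
    cstarGenerated (cstarGenerated.fst u v) (cstarGenerated.snd u v) = ⊤ := by
  set B := cstarGenerated u v
  have hmap : (cstarGenerated (cstarGenerated.fst u v) (cstarGenerated.snd u v)).map B.subtype =
      B := by
    have hB : IsClosed (B : Set D) := inferInstance
    change (StarAlgebra.adjoin ℂ _).topologicalClosure.map B.subtype = _
    rw [← StarSubalgebra.topologicalClosure_map _ _
      hB.isClosedEmbedding_subtypeVal.isClosedMap continuous_subtype_val, StarAlgHom.map_adjoin,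
      Set.image_pair]
    rfl
  refine top_le_iff.1 fun b _ => ?_
  obtain ⟨c, hc, hcb⟩ := hmap.ge b.2
  exact Subtype.ext hcb ▸ hc

lemma eq_top_of_isClosed_of_mem {a b : D} (hgen : cstarGenerated a b = ⊤)
    {S : StarSubalgebra ℂ D} (hS : IsClosed (S : Set D)) (ha : a ∈ S) (hb : b ∈ S) : S = ⊤ :=
  top_le_iff.1 <| hgen.symm.trans_le <| StarSubalgebra.topologicalClosure_minimal
    (StarAlgebra.adjoin_le (Set.pair_subset ha hb)) hS

lemma starAlgHom_ext_of_cstarGenerated_eq_top {E : Type*} [CStarAlgebra E] {a b : D}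
    (hgen : cstarGenerated a b = ⊤) {Φ Ψ : D →⋆ₐ[ℂ] E} (ha : Φ a = Ψ a) (hb : Φ b = Ψ b) :
    Φ = Ψ := by
  have hclosed : IsClosed (StarAlgHom.equalizer Φ Ψ : Set D) :=
    isClosed_eq (map_continuous Φ) (map_continuous Ψ)
  have htop := eq_top_of_isClosed_of_mem hgen hclosed ha hb
  exact StarAlgHom.ext fun x => (htop ▸ StarSubalgebra.mem_top : x ∈ StarAlgHom.equalizer Φ Ψ)

lemma denseRange_of_cstarGenerated_eq_top {C : Type*} [CStarAlgebra C] {a b : D}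
    (hgen : cstarGenerated a b = ⊤) (Φ : C →⋆ₐ[ℂ] D) (ha : a ∈ Set.range Φ)
    (hb : b ∈ Set.range Φ) : DenseRange Φ := by
  have htop := eq_top_of_isClosed_of_mem hgen Φ.range.isClosed_topologicalClosure
    (Φ.range.le_topologicalClosure ha) (Φ.range.le_topologicalClosure hb)
  exact fun x => (htop ▸ StarSubalgebra.mem_top : x ∈ Φ.range.topologicalClosure)

lemma continuous_apply_of_cstarGenerated_eq_top {X E : Type*} [TopologicalSpace X]
    [CStarAlgebra E] {a b : D} (hgen : cstarGenerated a b = ⊤) {α : X → D →⋆ₐ[ℂ] E}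
    (ha : Continuous fun x => α x a) (hb : Continuous fun x => α x b) (d : D) :
    Continuous fun x => α x d := by
  let S : StarSubalgebra ℂ D :=
    { carrier := {d | Continuous fun x => α x d}
      mul_mem' := fun hc hd => by
        simp only [Set.mem_ofPred_eq, map_mul] at *
        exact Continuous.mul hc hd
      add_mem' := fun hc hd => by
        simp only [Set.mem_ofPred_eq, map_add] at *
        exact Continuous.add hc hd
      algebraMap_mem' := fun z => by
        simpa [AlgHomClass.commutes] using continuous_const
      star_mem' := fun hd => by simpa [map_star] using Continuous.star hd }
  have hS : IsClosed (S : Set D) := by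
    refine isClosed_of_closure_subset fun d hd => ?_
    refine continuous_of_uniform_approx_of_continuous fun s hs => ?_
    obtain ⟨ε, hε, hs⟩ := Metric.mem_uniformity_dist.1 hs
    obtain ⟨c, hc, hdc⟩ := Metric.mem_closure_iff.1 hd ε hε
    refine ⟨_, hc, fun x => hs ?_⟩
    rw [dist_eq_norm] at hdc ⊢
    rw [← map_sub]
    exact (NonUnitalStarAlgHom.norm_apply_le (α x) _).trans_lt hdc
  exact (eq_top_of_isClosed_of_mem hgen hS ha hb ▸ StarSubalgebra.mem_top : d ∈ S)

instance : IsScalarTower (unitary ℂ) (unitary D) (unitary D) where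
  smul_assoc c x y := Subtype.ext (smul_mul_assoc c (x : D) y)

instance : SMulCommClass (unitary ℂ) (unitary D) (unitary D) where
  smul_comm c x y := Subtype.ext (mul_smul_comm c (x : D) y).symm

variable {u v : unitary D}

lemma exists_mem_closure_coe_eq {x : D}
    (hx : x ∈ Submonoid.closure ({(u : D), (v : D)} ∪ star {(u : D), (v : D)})) :
    ∃ w ∈ Subgroup.closure {u, v}, (w : D) = x := by
  have hle : Submonoid.closure ({(u : D), (v : D)} ∪ star {(u : D), (v : D)}) ≤
      (Subgroup.closure {u, v}).toSubmonoid.map (unitary D).subtype := by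
    have hu : u ∈ Subgroup.closure {u, v} := Subgroup.subset_closure (.inl rfl)
    have hv : v ∈ Subgroup.closure {u, v} := Subgroup.subset_closure (.inr rfl)
    refine Submonoid.closure_le.2 ?_
    rintro x ((rfl | rfl) | hx | hx)
    exacts [⟨u, hu, rfl⟩, ⟨v, hv, rfl⟩, ⟨u⁻¹, Subgroup.inv_mem _ hu, star_eq_iff_star_eq.1 hx⟩,
      ⟨v⁻¹, Subgroup.inv_mem _ hv, star_eq_iff_star_eq.1 hx⟩]
  exact hle hx

lemma continuousLinearMap_ext_on_closure (hgen : cstarGenerated (u : D) (v : D) = ⊤)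
    {f g : D →L[ℂ] ℂ} (hfg : ∀ w ∈ Subgroup.closure {u, v}, f w = g w) : f = g := by
  refine ContinuousLinearMap.ext_on
    (s := Submonoid.closure ({(u : D), (v : D)} ∪ star {(u : D), (v : D)})) ?_ fun x hx => ?_
  · rw [← StarAlgebra.adjoin_eq_span]
    exact fun x => (hgen ▸ StarSubalgebra.mem_top : x ∈ cstarGenerated (u : D) (v : D))
  · obtain ⟨w, hw, rfl⟩ := exists_mem_closure_coe_eq hx
    exact hfg w hw

lemma apply_mul_comm_of_conj_invariant (hgen : cstarGenerated (u : D) (v : D) = ⊤)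
    {f : D →L[ℂ] ℂ} (hu : ∀ a, f (Unitary.conjStarAlgAut ℂ D u a) = f a)
    (hv : ∀ a, f (Unitary.conjStarAlgAut ℂ D v a) = f a) (a b : D) : f (a * b) = f (b * a) := by
  let S : Subgroup (unitary D) :=
    { carrier := {w | ∀ a, f (Unitary.conjStarAlgAut ℂ D w a) = f a}
      one_mem' := fun a => by simp
      mul_mem' := fun hw hw' a => by
        rw [map_mul, StarAlgEquiv.mul_apply, hw, hw']
      inv_mem' := fun {w} hw a => by
        rw [← hw, ← StarAlgEquiv.mul_apply, ← map_mul, mul_inv_cancel, map_one]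
        rfl }
  have hS : Subgroup.closure {u, v} ≤ S := (Subgroup.closure_le S).2 (Set.pair_subset hu hv)
  have hword (w : unitary D) (hw : w ∈ Subgroup.closure {u, v}) : f (w * b) = f (b * w) := by
    rw [← hS hw (b * w), Unitary.conjStarAlgAut_apply]
    simp [mul_assoc]
  have hfun : f ∘L ContinuousLinearMap.mul ℂ D b = f ∘L (ContinuousLinearMap.mul ℂ D).flip b :=
    continuousLinearMap_ext_on_closure hgen fun w hw => (hword w hw).symm
  exact (congr($hfun a)).symm

/-- A tracial functional among the states, as a `TracialState`. -/
def IsState.toTracialState {φ : D →L[ℂ] ℂ} (hφ : IsState φ)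
    (htr : ∀ a b, φ (a * b) = φ (b * a)) : TracialState D where
  toLinearMap := φ
  nonneg := hφ.nonneg
  map_one := hφ.map_one
  trace := htr

/-- The inner automorphism `Unitary.conjStarAlgAut ℂ D w` as a continuous linear map. -/
def conjCLM (w : unitary D) : D →L[ℂ] D := ContinuousLinearMap.mulLeftRight ℂ D w (star w : D)

lemma norm_conjCLM_le_one (w : unitary D) : ‖conjCLM w‖ ≤ 1 :=
  ContinuousLinearMap.opNorm_le_bound _ zero_le_one fun a =>
    (NonUnitalStarAlgHom.norm_apply_le (Unitary.conjStarAlgAut ℂ D w) a).trans_eq (one_mul _).symm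

lemma conjStarAlgAut_eq_self_iff {w : unitary D} {x : D} :
    Unitary.conjStarAlgAut ℂ D w x = x ↔ Commute (w : D) x := by
  rw [commute_iff_eq, Unitary.conjStarAlgAut_apply, ← Unitary.coe_star, Unitary.star_eq_inv,
    ← Unitary.val_inv_toUnits_apply, Units.mul_inv_eq_iff_eq_mul, Unitary.val_toUnits_apply]

lemma conjStarAlgAut_apply_of_mul_eq_smul_mul {x y : unitary D} {ζ : unitary ℂ}
    (h : x * y = ζ • (y * x)) : Unitary.conjStarAlgAut ℂ D x y = ζ • (y : D) := by
  have hD : (x * y : D) = ζ • (y * x : D) := congrArg Subtype.val h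
  rw [Unitary.conjStarAlgAut_apply, hD, smul_mul_assoc, mul_assoc,
    Unitary.mul_star_self_of_mem x.2, mul_one]

lemma commute_conjStarAlgAut (hgen : cstarGenerated (u : D) (v : D) = ⊤)
    (hu : Commute ⁅u, v⁆ u) (hv : Commute ⁅u, v⁆ v) :
    Commute (Unitary.conjStarAlgAut ℂ D u) (Unitary.conjStarAlgAut ℂ D v) := by
  rw [← commutatorElement_eq_one_iff_commute, ← map_commutatorElement]
  have hid : (Unitary.conjStarAlgAut ℂ D ⁅u, v⁆ : D →⋆ₐ[ℂ] D) = StarAlgHom.id ℂ D :=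
    starAlgHom_ext_of_cstarGenerated_eq_top hgen
      (conjStarAlgAut_eq_self_iff.2 (hu.map (unitary D).subtype))
      (conjStarAlgAut_eq_self_iff.2 (hv.map (unitary D).subtype))
  exact StarAlgEquiv.ext fun a => congr($hid a)

lemma exists_tracialState_eq_of_commute (hgen : cstarGenerated (u : D) (v : D) = ⊤)
    (hu : Commute ⁅u, v⁆ u) (hv : Commute ⁅u, v⁆ v) {φ : D →L[ℂ] ℂ} (hφ : IsState φ) :
    ∃ τ : TracialState D, ∀ a, Commute (u : D) a → Commute (v : D) a → τ.toLinearMap a = φ a := by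
  let f := ergodicMean (norm_conjCLM_le_one u) φ
  let g := ergodicMean (norm_conjCLM_le_one v) f
  have hg_eq (a : D) (hua : Commute (u : D) a) (hva : Commute (v : D) a) : g a = φ a :=
    (ergodicMean_apply_of_isFixedPt (norm_conjCLM_le_one v) f
      (conjStarAlgAut_eq_self_iff.2 hva)).trans
      (ergodicMean_apply_of_isFixedPt (norm_conjCLM_le_one u) φ (conjStarAlgAut_eq_self_iff.2 hua))
  have hg : IsState g :=
    { norm_le_one := (norm_ergodicMean_le _ f).trans <|
        (norm_ergodicMean_le _ φ).trans hφ.norm_le_one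
      map_one := (hg_eq 1 (.one_right _) (.one_right _)).trans hφ.map_one }
  have hcomm : Commute (conjCLM u) (conjCLM v) :=
    ContinuousLinearMap.ext fun a => congr($((commute_conjStarAlgAut hgen hu hv).eq) a)
  have hgu (a : D) : g (Unitary.conjStarAlgAut ℂ D u a) = g a :=
    ergodicMean_apply_map_of_commute _ hcomm (ergodicMean_apply_map _ φ) a
  have hgv (a : D) : g (Unitary.conjStarAlgAut ℂ D v a) = g a := ergodicMean_apply_map _ f a
  exact ⟨hg.toTracialState (apply_mul_comm_of_conj_invariant hgen hgu hgv), hg_eq⟩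

end Generators

section CentralCommutator

open scoped commutatorElement

variable {D : Type*} [CStarAlgebra D]

lemma norm_commutator_sub_one (u v : unitary D) :
    ‖((⁅u, v⁆ : unitary D) : D) - 1‖ = ‖(u * v - v * u : D)‖ := by
  have hmul : (((⁅u, v⁆ : unitary D) : D) - 1) * ((v * u : unitary D) : D) = u * v - v * u := by
    rw [sub_mul, one_mul, ← Submonoid.coe_mul, commutatorElement_def]
    simp
  rw [← hmul, CStarRing.norm_mul_coe_unitary]

lemma continuousOn_log_spectrum {w : D} (hw : spectrum ℂ w ⊆ Complex.slitPlane) :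
    ContinuousOn Complex.log (spectrum ℂ w) :=
  fun _z hz => (continuousAt_clog (hw hz)).continuousWithinAt

lemma cfc_exp_cstarLog {w : D} [IsStarNormal w] (hw : spectrum ℂ w ⊆ Complex.slitPlane) :
    cfc Complex.exp (cstarLog w) = w :=
  calc cfc Complex.exp (cstarLog w) = cfc (fun z => Complex.exp (Complex.log z)) w :=
        (cfc_comp' Complex.exp Complex.log w Complex.continuous_exp.continuousOn
          (continuousOn_log_spectrum hw)).symm
    _ = cfc (fun z => z) w :=
        cfc_congr fun _z hz => Complex.exp_log (Complex.slitPlane_ne_zero (hw hz))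
    _ = w := cfc_id' ℂ w

lemma isStarNormal_sub_algebraMap (a : D) [IsStarNormal a] (c : ℂ) :
    IsStarNormal (a - algebraMap ℂ D c) :=
  have : IsStarNormal (algebraMap ℂ D c) := ⟨Algebra.commutes _ _ |>.symm⟩
  Commute.isStarNormal_sub <| (algebraMap_star_comm (A := D) c) ▸ (Algebra.commutes _ a).symm

variable {u v : unitary D}

lemma eq_algebraMap_of_forall_tracialState_eq (hgen : cstarGenerated (u : D) (v : D) = ⊤)
    (hu : Commute ⁅u, v⁆ u) (hv : Commute ⁅u, v⁆ v) {a : D} [IsStarNormal a] {c : ℂ}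
    (hua : Commute (u : D) a) (hva : Commute (v : D) a)
    (hτ : ∀ τ : TracialState D, τ.toLinearMap a = c) : a = algebraMap ℂ D c := by
  have := isStarNormal_sub_algebraMap a c
  by_contra hne
  obtain ⟨φ, hφ, hφ_ne⟩ := exists_isState_apply_ne_zero (sub_ne_zero.2 hne)
  obtain ⟨τ, hτφ⟩ := exists_tracialState_eq_of_commute hgen hu hv hφ
  refine hφ_ne ?_
  rw [map_sub, ← hτφ a hua hva, hτ, Algebra.algebraMap_eq_smul_one, map_smul, hφ.map_one,
    smul_eq_mul, mul_one, sub_self]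

lemma commutator_eq_exp_of_forall_tracialState_eq (hgen : cstarGenerated (u : D) (v : D) = ⊤)
    (hu : Commute ⁅u, v⁆ u) (hv : Commute ⁅u, v⁆ v) (hδ : ‖(u * v - v * u : D)‖ < 2) {c : ℂ}
    (hτ : ∀ τ : TracialState D, τ.toLinearMap (cstarLog ((⁅u, v⁆ : unitary D) : D)) = c) :
    ((⁅u, v⁆ : unitary D) : D) = algebraMap ℂ D (Complex.exp c) := by
  have hspec : spectrum ℂ ((⁅u, v⁆ : unitary D) : D) ⊆ Complex.slitPlane :=
    (Unitary.spectrum_subset_slitPlane_iff_norm_lt_two ⁅u, v⁆.2).2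
      ((norm_commutator_sub_one u v).trans_lt hδ)
  have hcomm {w : unitary D} (hw : Commute ⁅u, v⁆ w) :
      Commute (w : D) (cstarLog ((⁅u, v⁆ : unitary D) : D)) :=
    (Commute.cfc (hw.map (unitary D).subtype) (hw.inv_left.map (unitary D).subtype) _).symm
  have : IsStarNormal (cstarLog ((⁅u, v⁆ : unitary D) : D)) := cfc_predicate _ _
  have hlog : cstarLog ((⁅u, v⁆ : unitary D) : D) = algebraMap ℂ D c :=
    eq_algebraMap_of_forall_tracialState_eq hgen hu hv (hcomm hu) (hcomm hv) hτ
  rw [← cfc_exp_cstarLog hspec, hlog, cfc_algebraMap]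

end CentralCommutator

section QuotientNorm

open scoped CStarAlgebra

variable {A B : Type*} [CStarAlgebra A] [CStarAlgebra B]

/-- The function whose value at `star a * a` truncates the modulus of `a` at height `c`. -/
def truncation (c t : ℝ) : ℝ := c / max c √t

variable {c : ℝ}

lemma continuous_truncation (hc : 0 < c) : Continuous (truncation c) :=
  continuous_const.div (by fun_prop) fun _ => (lt_max_of_lt_left hc).ne'

lemma truncation_eq_one (hc : 0 < c) {t : ℝ} (ht : t ≤ c ^ 2) : truncation c t = 1 := by
  rw [truncation, max_eq_left (Real.sqrt_le_iff.2 ⟨hc.le, ht⟩), div_self hc.ne']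

lemma truncation_mul_self_mul_truncation_le (hc : 0 < c) {t : ℝ} (ht : 0 ≤ t) :
    truncation c t * t * truncation c t ≤ c ^ 2 := by
  have hle : √t / max c √t ≤ 1 := div_le_one_of_le₀ (le_max_right _ _) (by positivity)
  calc truncation c t * t * truncation c t = c ^ 2 * (√t / max c √t) ^ 2 := by
        rw [truncation, div_pow, Real.sq_sqrt ht]; ring
    _ ≤ c ^ 2 := mul_le_of_le_one_right (sq_nonneg c) (pow_le_one₀ (by positivity) hle)

lemma norm_mul_cfc_truncation_le (hc : 0 < c) (a : A) :
    ‖a * cfc (truncation c) (star a * a)‖ ≤ c := by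
  have hcont := continuous_truncation hc
  set b := cfc (truncation c) (star a * a)
  have hb : IsSelfAdjoint b := cfc_predicate (truncation c) _
  have hab : star (a * b) * (a * b) =
      cfc (fun t => truncation c t * t * truncation c t) (star a * a) := by
    rw [cfc_mul (fun t => truncation c t * t) (truncation c) _ (by fun_prop) (by fun_prop),
      cfc_mul (truncation c) (fun t => t) _ (by fun_prop) (by fun_prop),
      cfc_id' ℝ (star a * a), star_mul, hb.star_eq]
    simp only [b, mul_assoc]
  refine le_of_sq_le_sq ?_ hc.le
  rw [sq ‖_‖, ← CStarRing.norm_star_mul_self, hab]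
  refine norm_cfc_le (by positivity) fun t ht => ?_
  have ht0 : 0 ≤ t := spectrum_star_mul_self_nonneg t ht
  rw [Real.norm_of_nonneg (by rw [truncation]; positivity)]
  exact truncation_mul_self_mul_truncation_le hc ht0

lemma cfc_truncation_eq_one {b : B} (hc : 0 < c) (hb : ‖b‖ ≤ c) :
    cfc (truncation c) (star b * b) = 1 := by
  nontriviality B
  rw [← cfc_one ℝ (star b * b)]
  refine cfc_congr fun t ht => truncation_eq_one hc ?_
  calc t ≤ ‖star b * b‖ := (le_abs_self t).trans (spectrum.norm_le_norm_of_mem ht)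
    _ = ‖b‖ ^ 2 := by rw [CStarRing.norm_star_mul_self, sq]
    _ ≤ c ^ 2 := by gcongr

lemma exists_apply_eq_norm_le (Φ : A →⋆ₐ[ℂ] B) (a : A) :
    ∃ a', Φ a' = Φ a ∧ ‖a'‖ ≤ ‖Φ a‖ := by
  rcases eq_or_ne (Φ a) 0 with h0 | h0
  · exact ⟨0, by rw [map_zero, h0], by simp⟩
  have hc : 0 < ‖Φ a‖ := norm_pos_iff.2 h0
  have hone : Φ (cfc (truncation ‖Φ a‖) (star a * a)) = 1 := by
    rw [StarAlgHom.map_cfc Φ _ _ (continuous_truncation hc).continuousOn (map_continuous Φ)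
      (.star_mul_self a) ((IsSelfAdjoint.star_mul_self a).map Φ), map_mul, map_star,
      cfc_truncation_eq_one hc le_rfl]
  exact ⟨_, by rw [map_mul, hone, mul_one], norm_mul_cfc_truncation_le hc a⟩

lemma surjective_of_denseRange {Φ : A →⋆ₐ[ℂ] B} (h : DenseRange Φ) : Function.Surjective Φ := by
  let f : NormedAddGroupHom A B :=
    { toFun := Φ
      map_add' := map_add Φ
      bound' := ⟨1, fun a => by simpa using NonUnitalStarAlgHom.norm_apply_le Φ a⟩ }
  have hf : f.SurjectiveOnWith f.range 1 := by
    rintro _ ⟨a, rfl⟩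
    obtain ⟨a', ha', hnorm⟩ := exists_apply_eq_norm_le Φ a
    exact ⟨a', ha', hnorm.trans_eq (one_mul _).symm⟩
  intro b
  obtain ⟨a, ha, -⟩ := controlled_closure_of_complete one_pos one_pos hf b (h b)
  exact ⟨a, ha⟩

lemma norm_apply_eq_infDist_ker (Φ : A →⋆ₐ[ℂ] B) (a : A) :
    ‖Φ a‖ = Metric.infDist a (RingHom.ker (Φ : A →ₐ[ℂ] B) : Set A) := by
  apply le_antisymm
  · refine (Metric.le_infDist ⟨0, Ideal.zero_mem _⟩).2 fun x (hx : Φ x = 0) => ?_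
    calc ‖Φ a‖ = ‖Φ (a - x)‖ := by rw [map_sub, hx, sub_zero]
      _ ≤ dist a x := (NonUnitalStarAlgHom.norm_apply_le Φ _).trans_eq (dist_eq_norm a x).symm
  · obtain ⟨a', ha', hnorm⟩ := exists_apply_eq_norm_le Φ a
    have hker : Φ (a - a') = 0 := by rw [map_sub, ha', sub_self]
    calc Metric.infDist a _ ≤ dist a (a - a') := Metric.infDist_le_dist_of_mem hker
      _ = ‖a'‖ := by rw [dist_eq_norm, sub_sub_cancel]
      _ ≤ ‖Φ a‖ := hnorm

lemma isIsomorphicToQuotient_of_surjective {Φ : A →⋆ₐ[ℂ] B} (hΦ : Function.Surjective Φ) :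
    IsIsomorphicToQuotient B A :=
  ⟨RingHom.ker (Φ : A →ₐ[ℂ] B), inferInstance,
    Ideal.quotientKerAlgEquivOfSurjective (f := (Φ : A →ₐ[ℂ] B)) hΦ,
    isClosed_eq (map_continuous Φ) continuous_const, map_star Φ, norm_apply_eq_infDist_ker Φ⟩

end QuotientNorm

section UniversalProperty

open scoped CStarAlgebra commutatorElement

variable {D : Type*} [CStarAlgebra D] {θ : ℝ} {u v : unitary D}

/-- The number `e^{2πiθ}`, as a unitary scalar. -/
def rotationNumber (θ : ℝ) : unitary ℂ :=
  ⟨Complex.exp (2 * Real.pi * Complex.I * θ), by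
    rw [Unitary.mem_iff_self_mul_star, Complex.star_def, Complex.mul_conj,
      Complex.normSq_eq_norm_sq, Complex.norm_exp]
    simp⟩

lemma mul_eq_rotationNumber_smul_mul
    (h : ((⁅u, v⁆ : unitary D) : D) = algebraMap ℂ D (Complex.exp (2 * Real.pi * Complex.I * θ))) :
    u * v = rotationNumber θ • (v * u) := by
  apply Subtype.ext
  have hmul : u * v = ⁅u, v⁆ * (v * u) := by rw [commutatorElement_def]; group
  rw [hmul, Submonoid.coe_mul, h, Algebra.algebraMap_eq_smul_one, smul_one_mul]
  rfl

namespace PreRotation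

/-- The representation of the free ⋆-algebra on two unitaries determined by `u` and `v`. -/
def lift (u v : unitary D) : PreRotation θ →ₐ[ℂ] D :=
  MonoidAlgebra.lift ℂ D (FreeGroup (Fin 2)) ((unitary D).subtype.comp (FreeGroup.lift ![u, v]))

lemma lift_single (u v : unitary D) (g : FreeGroup (Fin 2)) (c : ℂ) :
    lift u v (single g c : PreRotation θ) = c • (FreeGroup.lift ![u, v] g : D) :=
  MonoidAlgebra.lift_single ..

lemma lift_U (u v : unitary D) : lift u v (U : PreRotation θ) = u := by
  rw [U, lift_single, FreeGroup.lift_apply_of, one_smul]; rfl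

lemma lift_V (u v : unitary D) : lift u v (V : PreRotation θ) = v := by
  rw [V, lift_single, FreeGroup.lift_apply_of, one_smul]; rfl

lemma lift_star (u v : unitary D) (a : PreRotation θ) :
    lift u v (star a) = star (lift u v a) := by
  induction a using induction with
  | h0 => simp
  | hs g c => rw [star_single, lift_single, lift_single, map_inv, star_smul]; rfl
  | hadd a b ha hb => rw [star_add, map_add, map_add, ha, hb, star_add]

lemma norm_lift_le (h : u * v = rotationNumber θ • (v * u)) (a : PreRotation θ) :
    ‖lift u v a‖ ≤ ‖a‖ :=
  le_universalNorm ⟨(normSeminorm ℂ D).comp (lift u v).toLinearMap,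
    { mul_le := fun a b => by simpa using norm_mul_le (lift u v a) (lift u v b)
      star_mul_self := fun a => by simp [lift_star, CStarRing.norm_star_mul_self, sq]
      relation := by
        have hD : (u * v : D) = Complex.exp (2 * Real.pi * Complex.I * θ) • (v * u : D) :=
          congrArg Subtype.val h
        simp [lift_U, lift_V, hD] }⟩ a

lemma continuous_lift (h : u * v = rotationNumber θ • (v * u)) :
    Continuous (lift u v : PreRotation θ →ₐ[ℂ] D) :=
  AddMonoidHomClass.continuous_of_bound _ 1 fun a => by simpa using norm_lift_le h a

end PreRotation

namespace RotationAlgebra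

open UniformSpace

lemma of_one : of (1 : PreRotation θ) = 1 := Completion.coe_one _

lemma of_zero : of (0 : PreRotation θ) = 0 := Completion.coe_zero

lemma of_sub (a b : PreRotation θ) : of (a - b) = of a - of b := Completion.coe_sub a b

/-- The ⋆-homomorphism from `A_θ` given by the universal property. -/
def lift (h : u * v = rotationNumber θ • (v * u)) : RotationAlgebra θ →⋆ₐ[ℂ] D :=
  let F : RotationAlgebra θ →+* D :=
    Completion.extensionHom (PreRotation.lift u v).toRingHom (PreRotation.continuous_lift h)
  have hF (a : PreRotation θ) : F (of a) = PreRotation.lift u v a :=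
    Completion.extensionHom_coe _ (PreRotation.continuous_lift h) a
  have hF_cont : Continuous F := Completion.continuous_extension
  { F with
    commutes' := fun r => by
      change F _ = _
      rw [Algebra.algebraMap_eq_smul_one, ← of_one, ← of_smul, hF, map_smul, map_one,
        Algebra.algebraMap_eq_smul_one]
    map_star' := fun a => by
      change F _ = star (F a)
      induction a using induction with
      | hc => exact isClosed_eq (hF_cont.comp continuous_star') hF_cont.star
      | h a => rw [star_of, hF, hF, PreRotation.lift_star] }

lemma lift_of (h : u * v = rotationNumber θ • (v * u)) (a : PreRotation θ) :
    lift h (of a) = PreRotation.lift u v a :=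
  Completion.extensionHom_coe _ (PreRotation.continuous_lift h) a

/-- The free group on two generators inside the unitary group of `A_θ`. -/
def word : FreeGroup (Fin 2) →* unitary (RotationAlgebra θ) where
  toFun g := ⟨of (PreRotation.single g 1), by
    simp [Unitary.mem_iff, star_of, PreRotation.star_single, ← of_mul, PreRotation.single_mul,
      ← of_one, PreRotation.one_eq]⟩
  map_one' := rfl
  map_mul' g h := Subtype.ext <| by
    change of _ = of _ * of _
    rw [← of_mul, PreRotation.single_mul, one_mul]

/-- The first canonical generator `u_θ` of `A_θ`. -/
def genU : unitary (RotationAlgebra θ) := word (FreeGroup.of 0)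

/-- The second canonical generator `v_θ` of `A_θ`. -/
def genV : unitary (RotationAlgebra θ) := word (FreeGroup.of 1)

lemma lift_genU (h : u * v = rotationNumber θ • (v * u)) :
    lift h (genU : unitary (RotationAlgebra θ)) = (u : D) :=
  (lift_of h _).trans (PreRotation.lift_U u v)

lemma lift_genV (h : u * v = rotationNumber θ • (v * u)) :
    lift h (genV : unitary (RotationAlgebra θ)) = (v : D) :=
  (lift_of h _).trans (PreRotation.lift_V u v)

lemma genU_mul_genV :
    genU * genV = rotationNumber θ • (genV * genU : unitary (RotationAlgebra θ)) := by
  apply Subtype.ext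
  change of PreRotation.U * of PreRotation.V =
    Complex.exp (2 * Real.pi * Complex.I * θ) • (of PreRotation.V * of PreRotation.U)
  rw [← of_mul, ← of_mul, ← of_smul, ← sub_eq_zero, ← of_sub, ← norm_eq_zero, norm_of]
  exact le_antisymm (PreRotation.universalNorm_le fun p => p.2.relation.le) (norm_nonneg _)

lemma of_single (g : FreeGroup (Fin 2)) (c : ℂ) :
    (of (PreRotation.single g c) : RotationAlgebra θ) =
      c • ((word g : unitary (RotationAlgebra θ)) : RotationAlgebra θ) := by
  change _ = c • of _
  rw [← of_smul, PreRotation.smul_single, mul_one]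

lemma word_mem {S : StarSubalgebra ℂ (RotationAlgebra θ)}
    (hU : (genU : unitary (RotationAlgebra θ)).1 ∈ S)
    (hV : (genV : unitary (RotationAlgebra θ)).1 ∈ S) (g : FreeGroup (Fin 2)) :
    (word g : unitary (RotationAlgebra θ)).1 ∈ S := by
  have hof (i : Fin 2) : (word (FreeGroup.of i) : unitary (RotationAlgebra θ)).1 ∈ S := by
    fin_cases i
    exacts [hU, hV]
  induction g using FreeGroup.induction_on with
  | C1 => rw [map_one]; exact one_mem S
  | of i => exact hof i
  | inv_of i _ => rw [map_inv]; exact star_mem (hof i)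
  | mul g h hg hh => rw [map_mul]; exact mul_mem hg hh

lemma cstarGenerated_genU_genV :
    cstarGenerated (genU : unitary (RotationAlgebra θ)).1 (genV : unitary (RotationAlgebra θ)).1 =
      ⊤ := by
  set S := cstarGenerated (genU : unitary (RotationAlgebra θ)).1
    (genV : unitary (RotationAlgebra θ)).1
  suffices h : ∀ a, a ∈ S from top_le_iff.1 fun a _ => h a
  intro a
  induction a using induction with
  | hc => exact (inferInstance : IsClosed (S : Set (RotationAlgebra θ)))
  | h a =>
    induction a using PreRotation.induction with
    | h0 => rw [of_zero]; exact zero_mem S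
    | hs g c =>
      rw [of_single]
      exact SMulMemClass.smul_mem c
        (word_mem (cstarGenerated.fst _ _).2 (cstarGenerated.snd _ _).2 g)
    | hadd a b ha hb => rw [of_add]; exact add_mem ha hb

lemma gauge_relation (z : unitary ℂ × unitary ℂ) :
    (z.1 • genU) * (z.2 • genV) =
      rotationNumber θ • ((z.2 • genV) * (z.1 • genU : unitary (RotationAlgebra θ))) := by
  apply Subtype.ext
  have h := congrArg Subtype.val (genU_mul_genV (θ := θ))
  simp only [Submonoid.coe_mul, Unitary.coe_smul] at h ⊢
  rw [smul_mul_smul_comm, smul_mul_smul_comm, h, smul_comm, mul_comm z.1]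

/-- The gauge action of the torus on `A_θ`. -/
def gauge : unitary ℂ × unitary ℂ →* (RotationAlgebra θ →⋆ₐ[ℂ] RotationAlgebra θ) where
  toFun z := lift (gauge_relation z)
  map_one' := starAlgHom_ext_of_cstarGenerated_eq_top cstarGenerated_genU_genV
    ((lift_genU _).trans (one_smul _ _)) ((lift_genV _).trans (one_smul _ _))
  map_mul' z w := starAlgHom_ext_of_cstarGenerated_eq_top
    (Ψ := (lift (gauge_relation z)).comp (lift (gauge_relation w))) cstarGenerated_genU_genV
    (by simp [lift_genU, Submonoid.smul_def, smul_smul, mul_comm])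
    (by simp [lift_genV, Submonoid.smul_def, smul_smul, mul_comm])

lemma gauge_genU (z : unitary ℂ × unitary ℂ) :
    gauge z (genU : unitary (RotationAlgebra θ)).1 = z.1 • (genU : unitary (RotationAlgebra θ)).1 :=
  lift_genU (gauge_relation z)

lemma gauge_genV (z : unitary ℂ × unitary ℂ) :
    gauge z (genV : unitary (RotationAlgebra θ)).1 = z.2 • (genV : unitary (RotationAlgebra θ)).1 :=
  lift_genV (gauge_relation z)

lemma continuous_gauge_apply (a : RotationAlgebra θ) : Continuous fun z => gauge z a :=
  continuous_apply_of_cstarGenerated_eq_top cstarGenerated_genU_genV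
    (by simp only [gauge_genU]; fun_prop) (by simp only [gauge_genV]; fun_prop) a

lemma conjStarAlgAut_genU (a : RotationAlgebra θ) :
    Unitary.conjStarAlgAut ℂ (RotationAlgebra θ) genU a = gauge (1, rotationNumber θ) a := by
  have hU : Unitary.conjStarAlgAut ℂ (RotationAlgebra θ) genU genU.1 =
      gauge (1, rotationNumber θ) genU.1 := by
    rw [gauge_genU, one_smul, conjStarAlgAut_eq_self_iff]
  have hV : Unitary.conjStarAlgAut ℂ (RotationAlgebra θ) genU genV.1 =
      gauge (1, rotationNumber θ) genV.1 := by
    rw [gauge_genV, conjStarAlgAut_apply_of_mul_eq_smul_mul genU_mul_genV]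
  exact congr($(starAlgHom_ext_of_cstarGenerated_eq_top cstarGenerated_genU_genV (Φ :=
    (Unitary.conjStarAlgAut ℂ (RotationAlgebra θ) genU : _ ≃⋆ₐ[ℂ] RotationAlgebra θ)) hU hV) a)

lemma conjStarAlgAut_genV (a : RotationAlgebra θ) :
    Unitary.conjStarAlgAut ℂ (RotationAlgebra θ) genV a = gauge ((rotationNumber θ)⁻¹, 1) a := by
  have hU : Unitary.conjStarAlgAut ℂ (RotationAlgebra θ) genV genU.1 =
      gauge ((rotationNumber θ)⁻¹, 1) genU.1 := by
    rw [gauge_genU, conjStarAlgAut_apply_of_mul_eq_smul_mul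
      (eq_inv_smul_iff.2 genU_mul_genV.symm)]
  have hV : Unitary.conjStarAlgAut ℂ (RotationAlgebra θ) genV genV.1 =
      gauge ((rotationNumber θ)⁻¹, 1) genV.1 := by
    rw [gauge_genV, one_smul, conjStarAlgAut_eq_self_iff]
  exact congr($(starAlgHom_ext_of_cstarGenerated_eq_top cstarGenerated_genU_genV (Φ :=
    (Unitary.conjStarAlgAut ℂ (RotationAlgebra θ) genV : _ ≃⋆ₐ[ℂ] RotationAlgebra θ)) hU hV) a)

end RotationAlgebra

end UniversalProperty

section UniqueTrace

section Group

variable {S G : Type*} [Group S] [Group G] [MulAction S G] [IsScalarTower S G G]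
  [SMulCommClass S G G] {ζ : S} {u v : G}

lemma zpow_mul_zpow_of_mul_eq_smul_mul (h : u * v = ζ • (v * u)) (m n : ℤ) :
    u ^ m * v ^ n = ζ ^ (m * n) • (v ^ n * u ^ m) := by
  have hvu : SemiconjBy v u (ζ⁻¹ • u) := by
    rw [SemiconjBy, smul_mul_assoc, h, inv_smul_smul]
  have huv : SemiconjBy (u ^ m) v (ζ ^ m • v) := by
    rw [SemiconjBy, smul_mul_assoc, (hvu.zpow_right m).eq, smul_zpow, smul_mul_assoc, smul_smul,
      inv_zpow, mul_inv_cancel, one_smul]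
  rw [(huv.zpow_right n).eq, smul_zpow, smul_mul_assoc, zpow_mul]

lemma exists_eq_smul_zpow_mul_zpow (h : u * v = ζ • (v * u)) {w : G}
    (hw : w ∈ Subgroup.closure {u, v}) : ∃ (c : S) (m n : ℤ), w = c • (u ^ m * v ^ n) := by
  have hvu (k m : ℤ) : v ^ k * u ^ m = ζ ^ (-(m * k)) • (u ^ m * v ^ k) := by
    rw [zpow_mul_zpow_of_mul_eq_smul_mul h, smul_smul, ← zpow_add, neg_add_cancel, zpow_zero,
      one_smul]
  have hu (k m n : ℤ) (c : S) :
      u ^ k * (c • (u ^ m * v ^ n)) = c • (u ^ (k + m) * v ^ n) := by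
    rw [mul_smul_comm, ← mul_assoc, zpow_add]
  have hv (k m n : ℤ) (c : S) :
      v ^ k * (c • (u ^ m * v ^ n)) = (c * ζ ^ (-(m * k))) • (u ^ m * v ^ (k + n)) := by
    rw [mul_smul_comm, ← mul_assoc, hvu, smul_mul_assoc, smul_smul, mul_assoc, zpow_add]
  induction hw using Subgroup.closure_induction_left with
  | one => exact ⟨1, 0, 0, by simp⟩
  | mul_left x hx y _ hy =>
    obtain ⟨c, m, n, rfl⟩ := hy
    rcases hx with rfl | rfl
    exacts [⟨_, _, _, zpow_one x ▸ hu 1 m n c⟩, ⟨_, _, _, zpow_one x ▸ hv 1 m n c⟩]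
  | inv_mul_cancel x hx y _ hy =>
    obtain ⟨c, m, n, rfl⟩ := hy
    rcases hx with rfl | rfl
    exacts [⟨_, _, _, zpow_neg_one x ▸ hu (-1) m n c⟩,
      ⟨_, _, _, zpow_neg_one x ▸ hv (-1) m n c⟩]

end Group

variable {D : Type*} [CStarAlgebra D] {u v : unitary D} {ζ : unitary ℂ}

namespace TracialState

/-- A tracial state as a continuous linear functional. -/
def toContinuousLinearMap (τ : TracialState D) : D →L[ℂ] ℂ where
  toLinearMap := τ.toLinearMap
  cont := by
    let := CStarAlgebra.spectralOrder D
    have := CStarAlgebra.spectralOrderedRing D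
    have hpos (a : D) (ha : 0 ≤ a) : 0 ≤ τ.toLinearMap a := by
      obtain ⟨b, rfl⟩ := CStarAlgebra.nonneg_iff_eq_star_mul_self.1 ha
      exact τ.nonneg b
    exact map_continuous (PositiveLinearMap.mk₀ τ.toLinearMap hpos)

lemma apply_eq_zero_of_mul_eq_smul_mul (τ : TracialState D) (h : u * v = ζ • (v * u))
    (hζ : ζ ≠ 1) : τ.toLinearMap v = 0 := by
  have hconj : τ.toLinearMap (Unitary.conjStarAlgAut ℂ D u v) = τ.toLinearMap v := by
    rw [Unitary.conjStarAlgAut_apply, τ.trace, ← mul_assoc, Unitary.star_mul_self_of_mem u.2,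
      one_mul]
  rw [conjStarAlgAut_apply_of_mul_eq_smul_mul h, Submonoid.smul_def, map_smul, smul_eq_mul,
    ← sub_eq_zero, ← sub_one_mul] at hconj
  exact (mul_eq_zero.1 hconj).resolve_left (sub_ne_zero.2 (by simpa using hζ))

lemma apply_zpow_mul_zpow_eq_zero (τ : TracialState D) (h : u * v = ζ • (v * u))
    (hζ : ∀ n : ℤ, n ≠ 0 → ζ ^ n ≠ 1) {m n : ℤ} (hmn : m ≠ 0 ∨ n ≠ 0) :
    τ.toLinearMap ((u ^ m * v ^ n : unitary D) : D) = 0 := by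
  rcases hmn with hm | hn
  · have hvu : v * u ^ m = ζ ^ (-m) • (u ^ m * v) := by
      simpa [eq_inv_smul_iff] using (zpow_mul_zpow_of_mul_eq_smul_mul h m 1).symm
    refine τ.apply_eq_zero_of_mul_eq_smul_mul (u := v) ?_ (hζ (-m) (neg_ne_zero.2 hm))
    rw [← mul_assoc, hvu, smul_mul_assoc, mul_assoc, mul_assoc, (Commute.self_zpow v n).eq]
  · have huv : u * v ^ n = ζ ^ n • (v ^ n * u) := by
      simpa using zpow_mul_zpow_of_mul_eq_smul_mul h 1 n
    refine τ.apply_eq_zero_of_mul_eq_smul_mul (u := u) ?_ (hζ n hn)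
    rw [← mul_assoc, (Commute.self_zpow u m).eq, mul_assoc, huv, mul_smul_comm, mul_assoc]

lemma toLinearMap_eq_of_mul_eq_smul_mul (hgen : cstarGenerated (u : D) (v : D) = ⊤)
    (h : u * v = ζ • (v * u)) (hζ : ∀ n : ℤ, n ≠ 0 → ζ ^ n ≠ 1) (τ τ' : TracialState D) :
    τ.toLinearMap = τ'.toLinearMap := by
  suffices τ.toContinuousLinearMap = τ'.toContinuousLinearMap from congr(($this).toLinearMap)
  refine continuousLinearMap_ext_on_closure hgen fun w hw => ?_
  change τ.toLinearMap w = τ'.toLinearMap w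
  obtain ⟨c, m, n, rfl⟩ := exists_eq_smul_zpow_mul_zpow h hw
  rw [Unitary.coe_smul, Submonoid.smul_def, map_smul, map_smul]
  congr 1
  by_cases hmn : m ≠ 0 ∨ n ≠ 0
  · rw [τ.apply_zpow_mul_zpow_eq_zero h hζ hmn, τ'.apply_zpow_mul_zpow_eq_zero h hζ hmn]
  · obtain ⟨rfl, rfl⟩ : m = 0 ∧ n = 0 := by tauto
    simp [τ.map_one, τ'.map_one]

end TracialState

lemma rotationNumber_zpow_ne_one {θ : ℝ} (hθ : Irrational θ) {n : ℤ} (hn : n ≠ 0) :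
    rotationNumber θ ^ n ≠ 1 := by
  intro h
  have hexp : Complex.exp (n * (2 * Real.pi * Complex.I * θ)) = 1 := by
    rw [Complex.exp_int_mul]
    simpa [rotationNumber, Unitary.coe_zpow] using congrArg Subtype.val h
  obtain ⟨k, hk⟩ := Complex.exp_eq_one_iff.1 hexp
  have hnθ : (n * θ : ℂ) = k :=
    mul_right_cancel₀ Complex.two_pi_I_ne_zero (by linear_combination hk)
  exact (hθ.intCast_mul hn).ne_int k (by exact_mod_cast hnθ)

end UniqueTrace

section RotationAlgebraTrace

variable {D : Type*} [CStarAlgebra D]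

instance [ProperSpace D] : CompactSpace (unitary D) :=
  isCompact_iff_compactSpace.1 <| Metric.isCompact_of_isClosed_isBounded isClosed_unitary <|
    isBounded_iff_forall_norm_le.2 ⟨1, fun _x hx => by
      nontriviality D
      exact (CStarRing.norm_of_mem_unitary hx).le⟩

/-- The pullback of a tracial state along a ⋆-homomorphism. -/
def TracialState.comap {E : Type*} [CStarAlgebra E] (τ : TracialState E) (Φ : D →⋆ₐ[ℂ] E) :
    TracialState D where
  toLinearMap := τ.toLinearMap ∘ₗ Φ.toAlgHom.toLinearMap
  nonneg a := by simpa [map_star] using τ.nonneg (Φ a)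
  map_one := by simpa using τ.map_one
  trace a b := by simpa using τ.trace (Φ a) (Φ b)

namespace RotationAlgebra

variable {θ : ℝ}

lemma apply_mul_comm_of_gauge_invariant {ψ : RotationAlgebra θ →L[ℂ] ℂ}
    (hψ : ∀ z a, ψ (gauge z a) = ψ a) (a b : RotationAlgebra θ) : ψ (a * b) = ψ (b * a) :=
  apply_mul_comm_of_conj_invariant cstarGenerated_genU_genV
    (fun a => (congrArg ψ (conjStarAlgAut_genU a)).trans (hψ _ a))
    (fun a => (congrArg ψ (conjStarAlgAut_genV a)).trans (hψ _ a)) a b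

lemma eq_zero_of_tracialState_apply_star_mul_self_eq_zero (hθ : Irrational θ)
    (τ : TracialState (RotationAlgebra θ)) {a : RotationAlgebra θ}
    (ha : τ.toLinearMap (star a * a) = 0) : a = 0 := by
  by_contra ha0
  have := (IsSelfAdjoint.star_mul_self a).isStarNormal
  obtain ⟨φ, hφ, hφa⟩ :=
    exists_isState_apply_ne_zero ((CStarRing.star_mul_self_ne_zero_iff a).2 ha0)
  obtain ⟨ψ, hψ, hinv, hψφ⟩ := hφ.exists_invariant continuous_gauge_apply
  have hψτ : (ψ : RotationAlgebra θ →ₗ[ℂ] ℂ) = τ.toLinearMap :=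
    TracialState.toLinearMap_eq_of_mul_eq_smul_mul cstarGenerated_genU_genV genU_mul_genV
      (fun _n hn => rotationNumber_zpow_ne_one hθ hn)
      (hψ.toTracialState (apply_mul_comm_of_gauge_invariant hinv)) τ
  exact hφa (hψφ a (congr($hψτ (star a * a)).trans ha))

lemma injective_of_irrational (hθ : Irrational θ) (Φ : RotationAlgebra θ →⋆ₐ[ℂ] D)
    (τ : TracialState D) : Function.Injective Φ :=
  (injective_iff_map_eq_zero Φ).2 fun a ha =>
    eq_zero_of_tracialState_apply_star_mul_self_eq_zero hθ (τ.comap Φ) <| by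
      simp [TracialState.comap, ha]

end RotationAlgebra

end RotationAlgebraTrace

end

open scoped commutatorElement

theorem theorem3p7 {A : Type*} [CStarAlgebra A] (u v : A)
    (hu : u ∈ unitary A) (hv : v ∈ unitary A)
    (hδ : ‖u * v - v * u‖ < 2)
    (hcu : Commute (u * v * star u * star v) u)
    (hcv : Commute (u * v * star u * star v) v)
    (θ : ℝ) (hθ : θ ∈ Set.Ioo (-(1 / 2) : ℝ) (1 / 2))
    (hT : Nonempty (TracialState (cstarGenerated u v)))
    (hτ : ∀ τ : TracialState (cstarGenerated u v),
      1 / (2 * Real.pi * Complex.I) *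
        τ.toLinearMap (cstarLog (cstarGenerated.commutator u v)) = (θ : ℂ)) :
    IsIsomorphicToQuotient (cstarGenerated u v) (RotationAlgebra θ) ∧
      u * v = Complex.exp (2 * Real.pi * Complex.I * θ) • (v * u) ∧
      (Irrational θ → Nonempty (cstarGenerated u v ≃⋆ₐ[ℂ] RotationAlgebra θ)) := by
  let x : unitary (cstarGenerated u v) :=
    ⟨cstarGenerated.fst u v, Subtype.ext hu.1, Subtype.ext hu.2⟩
  let y : unitary (cstarGenerated u v) :=
    ⟨cstarGenerated.snd u v, Subtype.ext hv.1, Subtype.ext hv.2⟩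
  have hgen : cstarGenerated x.1 y.1 = ⊤ := cstarGenerated_fst_snd u v
  have hlog (τ : TracialState (cstarGenerated u v)) :
      τ.toLinearMap (cstarLog ((⁅x, y⁆ : unitary _) : cstarGenerated u v)) =
        2 * Real.pi * Complex.I * θ := by
    have := hτ τ
    rwa [one_div, inv_mul_eq_iff_eq_mul₀ Complex.two_pi_I_ne_zero] at this
  have hcomm := commutator_eq_exp_of_forall_tracialState_eq hgen
    (Subtype.ext (Subtype.ext hcu)) (Subtype.ext (Subtype.ext hcv)) hδ hlog
  have hrel : x * y = rotationNumber θ • (y * x) := mul_eq_rotationNumber_smul_mul hcomm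
  let Φ := RotationAlgebra.lift hrel
  have hΦ : Function.Surjective Φ := surjective_of_denseRange <|
    denseRange_of_cstarGenerated_eq_top hgen Φ
      ⟨_, RotationAlgebra.lift_genU hrel⟩ ⟨_, RotationAlgebra.lift_genV hrel⟩
  refine ⟨isIsomorphicToQuotient_of_surjective hΦ, congr($hrel), fun hirr => ?_⟩
  obtain ⟨τ⟩ := hT
  have hΦ_inj := RotationAlgebra.injective_of_irrational hirr Φ τ
  exact ⟨(StarAlgEquiv.ofBijective Φ ⟨hΦ_inj, hΦ⟩).symm⟩
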